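/- Let $\mathfrak{su}(2)$ be the real Lie algebra of trace-free skew-Hermitian complex $2\times 2$ matrices and let $B$ be minus its Killing form. Let $\alpha$ be the simple root $\mathrm{diag}(x,-x)\mapsto 2x$, let $h_\alpha=\mathrm{diag}(\tfrac12,-\tfrac12)$ (so that $\alpha(h_\alpha)=1$), and let $E_\alpha=\tfrac{1}{\sqrt2}\begin{pmatrix}0&1\\0&0\end{pmatrix}$, $E_{-\alpha}=\tfrac1{\sqrt2}\begin{pmatrix}0&0\\1&0\end{pmatrix}$ (so that $[E_\alpha,E_{-\alpha}]=h_\alpha$). Put $$X_\alpha=\tfrac{1}{\sqrt2}(E_\alpha-E_{-\alpha}),\qquad Y_\alpha=\tfrac{\sqrt{-1}}{\sqrt2}(E_\alpha+E_{-\alpha}),$$ so that $\{\sqrt{-1}h_\alpha,X_\alpha,Y_\alpha\}$ is a $B$-orthogonal basis of $\mathfrak{su}(2)$ with $[\sqrt{-1}h_\alpha,X_\alpha]=Y_\alpha$, $[\sqrt{-1}h_\alpha,Y_\alpha]=-X_\alpha$ and $[X_\alpha,Y_\alpha]=\sqrt{-1}h_\alpha$. Let $\mathfrak m_1,\mathfrak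 m_2,\mathfrak m_3$ be the real lines spanned by $\sqrt{-1}h_\alpha$, $X_\alpha$, $Y_\alpha$ respectively. For positive real numbers $\lambda_1,\lambda_2,\lambda_3$, give $SU(2)$ the left-invariant Riemannian metric whose value at the identity is the scalar product $$\langle\cdot,\cdot\rangle=\lambda_1B|_{\mathfrak m_1}+\lambda_2B|_{\mathfrak m_2}+\lambda_3B|_{\mathfrak m_3}$$ (with $\mathfrak m_1,\mathfrak m_2,\mathfrak m_3$ pairwise orthogonal). A nonzero vector $X\in\mathfrak{su}(2)$ is called a geodesic vector if the curve $t\mapsto\exp(tX)$, $t\in\mathbb R$, is a geodesic of this metric, that is, a smooth curve whose restriction to every compact interval is a critical point of the energy for smooth variations with fixed end points. **Proposition.** 1. If $\{i,j,k\}=\{1,2,3\}$ and $\lambda_i=\lambda_j\neq\lambda_k$, then the geodesic vectors are exactly the nonzero vectors of $\mathfrak m_k$ and the nonzero vectors of $\mathfrak m_i\oplus\mathfrak m_j$. 2. If $\lambda_1,\lambda_2,\lambda_3$ are pairwise distinct, then the geodesic vectors are exactly the nonzero vectors of $\mathfrak m_1\cup\mathfrak m_2\cup\mathfrak m_3$.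 -/

import Mathlib

open scoped ContDiff

-- the commutator bracket on matrices
attribute [local instance 100] LieRing.ofAssociativeRing

namespace SU2Geodesic

/-! ### The group `SU(2)` and its Lie algebra -/

/-- The Lie group `SU(2)`, as an (embedded) matrix group. -/
abbrev SU2 : Type := Matrix.specialUnitaryGroup (Fin 2) ℂ

/-- The real Lie algebra `𝔰𝔲(2)` of trace-free skew-Hermitian complex `2 × 2` matrices, with the
commutator bracket. It is the tangent space of `SU(2)` at the identity. -/
def su2 : LieSubalgebra ℝ (Matrix (Fin 2) (Fin 2) ℂ) where
  carrier := {A | star A = -A ∧ A.trace = 0}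
  add_mem' := by
    rintro A B ⟨hA, hA'⟩ ⟨hB, hB'⟩
    refine ⟨?_, by rw [Matrix.trace_add, hA', hB', add_zero]⟩
    rw [star_add, hA, hB, neg_add]
  zero_mem' := ⟨by simp, by simp⟩
  smul_mem' := by
    rintro c A ⟨hA, hA'⟩
    refine ⟨?_, by rw [Matrix.trace_smul, hA', smul_zero]⟩
    rw [star_smul, hA, smul_neg, star_trivial]
  lie_mem' := by
    rintro A B ⟨hA, -⟩ ⟨hB, -⟩
    refine ⟨?_, ?_⟩
    · rw [Ring.lie_def, star_sub, star_mul, star_mul, hA, hB]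
      noncomm_ring
    · rw [Ring.lie_def, Matrix.trace_sub, Matrix.trace_mul_comm, sub_self]

theorem mem_su2 {A : Matrix (Fin 2) (Fin 2) ℂ} : A ∈ su2 ↔ star A = -A ∧ A.trace = 0 := Iff.rfl

/-! ### The basis `√-1 h_α, X_α, Y_α` -/

/-- The coroot-type element `h_α = diag (1/2, -1/2)`, normalised by `α (h_α) = 1`, where `α` is the
simple root `diag (x, -x) ↦ 2 x`. -/
noncomputable def hAlpha : Matrix (Fin 2) (Fin 2) ℂ := !![1 / 2, 0; 0, -1 / 2]

/-- The root vector `E_α`, normalised together with `E_{-α}` by `[E_α, E_{-α}] = h_α`. -/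
noncomputable def EAlpha : Matrix (Fin 2) (Fin 2) ℂ := !![0, 1 / (Real.sqrt 2 : ℂ); 0, 0]

/-- The root vector `E_{-α}`. -/
noncomputable def ENegAlpha : Matrix (Fin 2) (Fin 2) ℂ := !![0, 0; 1 / (Real.sqrt 2 : ℂ), 0]

/-- The three matrices `√-1 h_α`, `X_α = (E_α - E_{-α}) / √2`, `Y_α = √-1 (E_α + E_{-α}) / √2`.
They satisfy `[√-1 h_α, X_α] = Y_α`, `[√-1 h_α, Y_α] = -X_α`, `[X_α, Y_α] = √-1 h_α`. -/
noncomputable def frameMatrix : Fin 3 → Matrix (Fin 2) (Fin 2) ℂ :=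
  ![Complex.I • hAlpha,
    (1 / (Real.sqrt 2 : ℂ)) • (EAlpha - ENegAlpha),
    (1 / (Real.sqrt 2 : ℂ)) • (Complex.I • (EAlpha + ENegAlpha))]

theorem sqrt_two_inv_mul : ((Real.sqrt 2 : ℂ))⁻¹ * ((Real.sqrt 2 : ℂ))⁻¹ = 1 / 2 := by
  rw [← mul_inv, ← Complex.ofReal_mul, Real.mul_self_sqrt (by norm_num)]
  norm_num

theorem frameMatrix_zero : frameMatrix 0 = !![Complex.I / 2, 0; 0, -Complex.I / 2] := by
  ext i j
  fin_cases i <;> fin_cases j <;> simp [frameMatrix, hAlpha] <;> ring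

theorem frameMatrix_one : frameMatrix 1 = !![0, 1 / 2; -1 / 2, 0] := by
  have h := sqrt_two_inv_mul
  ext i j
  fin_cases i <;> fin_cases j <;> simp [frameMatrix, EAlpha, ENegAlpha]
  · linear_combination h
  · linear_combination -h

theorem frameMatrix_two : frameMatrix 2 = !![0, Complex.I / 2; Complex.I / 2, 0] := by
  have h := sqrt_two_inv_mul
  ext i j
  fin_cases i <;> fin_cases j <;> simp [frameMatrix, EAlpha, ENegAlpha] <;>
    linear_combination Complex.I * h

theorem frameMatrix_mem (i : Fin 3) : frameMatrix i ∈ su2 := by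
  rw [mem_su2]
  fin_cases i
  · change star (frameMatrix 0) = -frameMatrix 0 ∧ (frameMatrix 0).trace = 0
    rw [frameMatrix_zero]
    refine ⟨?_, by simp [Matrix.trace_fin_two]; ring⟩
    ext i j
    fin_cases i <;> fin_cases j <;> simp [Matrix.star_apply] <;> ring
  · change star (frameMatrix 1) = -frameMatrix 1 ∧ (frameMatrix 1).trace = 0
    rw [frameMatrix_one]
    refine ⟨?_, by simp [Matrix.trace_fin_two]⟩
    ext i j
    fin_cases i <;> fin_cases j <;> simp [Matrix.star_apply] <;> ring
  · change star (frameMatrix 2) = -frameMatrix 2 ∧ (frameMatrix 2).trace = 0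
    rw [frameMatrix_two]
    refine ⟨?_, by simp [Matrix.trace_fin_two]⟩
    ext i j
    fin_cases i <;> fin_cases j <;> simp [Matrix.star_apply] <;> ring

/-- The vectors `√-1 h_α, X_α, Y_α` (indices `0, 1, 2`) as elements of `𝔰𝔲(2)`. -/
noncomputable def frameVec (i : Fin 3) : su2 := ⟨frameMatrix i, frameMatrix_mem i⟩

theorem frameVec_sum_eq (c : Fin 3 → ℝ) :
    ((∑ i, c i • frameVec i : su2) : Matrix (Fin 2) (Fin 2) ℂ) =
      !![Complex.I * c 0 / 2, (c 1 + Complex.I * c 2) / 2;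
        (-c 1 + Complex.I * c 2) / 2, -(Complex.I * c 0) / 2] := by
  have h : ((∑ i, c i • frameVec i : su2) : Matrix (Fin 2) (Fin 2) ℂ) =
      c 0 • frameMatrix 0 + c 1 • frameMatrix 1 + c 2 • frameMatrix 2 := by
    rw [Fin.sum_univ_three]
    rfl
  rw [h, frameMatrix_zero, frameMatrix_one, frameMatrix_two]
  ext i j
  fin_cases i <;> fin_cases j <;> simp <;> ring

theorem frameVec_linearIndependent : LinearIndependent ℝ frameVec := by
  rw [Fintype.linearIndependent_iff]
  intro c hc
  have h := frameVec_sum_eq c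
  rw [hc] at h
  have h00 := congrArg Complex.im (congrFun (congrFun h 0) 0)
  have h01 := congrArg Complex.re (congrFun (congrFun h 0) 1)
  have h01' := congrArg Complex.im (congrFun (congrFun h 0) 1)
  simp at h00 h01 h01'
  intro i
  fin_cases i
  · change c 0 = 0
    linarith
  · change c 1 = 0
    linarith
  · change c 2 = 0
    linarith

theorem frameVec_span : ⊤ ≤ Submodule.span ℝ (Set.range frameVec) := by
  rintro ⟨A, hA, hA'⟩ -
  have h00 := congrFun (congrFun hA 0) 0
  have h01 := congrFun (congrFun hA 0) 1
  have hT : A 0 0 + A 1 1 = 0 := by rw [← Matrix.trace_fin_two, hA']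
  rw [Matrix.star_apply, Matrix.neg_apply] at h00 h01
  have key : (⟨A, hA, hA'⟩ : su2) =
      ∑ i, (![2 * (A 0 0).im, 2 * (A 0 1).re, 2 * (A 0 1).im] : Fin 3 → ℝ) i • frameVec i := by
    apply Subtype.ext
    rw [frameVec_sum_eq]
    have r00 := congrArg Complex.re h00
    have r01 := congrArg Complex.re h01
    have i01 := congrArg Complex.im h01
    have rt := congrArg Complex.re hT
    have it := congrArg Complex.im hT
    simp at r00 r01 i01 rt it
    ext i j
    fin_cases i <;> fin_cases j <;> apply Complex.ext <;> simp <;> linarith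
  rw [key]
  exact Submodule.sum_mem _ fun i _ =>
    Submodule.smul_mem _ _ (Submodule.subset_span ⟨i, rfl⟩)

/-- The basis `√-1 h_α, X_α, Y_α` of `𝔰𝔲(2)`. -/
noncomputable def frame : Module.Basis (Fin 3) ℝ su2 :=
  Module.Basis.mk frameVec_linearIndependent frameVec_span

/-- The lines `𝔪₁ = ℝ √-1 h_α`, `𝔪₂ = ℝ X_α`, `𝔪₃ = ℝ Y_α` (indices `0, 1, 2`). -/
noncomputable def m (i : Fin 3) : Submodule ℝ su2 := Submodule.span ℝ {frame i}

/-! ### The left-invariant metric `(λ₁, λ₂, λ₃)` -/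

/-- The form `B`, minus the Killing form of `𝔰𝔲(2)`. -/
noncomputable def B (U V : su2) : ℝ := -(killingForm ℝ su2 U V)

/-- The projection of `𝔰𝔲(2) = 𝔪₁ ⊕ 𝔪₂ ⊕ 𝔪₃` onto the summand `𝔪ᵢ`. -/
noncomputable def proj (i : Fin 3) (U : su2) : su2 := frame.repr U i • frame i

/-- The scalar product `⟨·,·⟩ = λ₁ B|𝔪₁ + λ₂ B|𝔪₂ + λ₃ B|𝔪₃` on `𝔰𝔲(2)`. -/
noncomputable def innerLam (lam : Fin 3 → ℝ) (U V : su2) : ℝ :=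
  ∑ i, lam i * B (proj i U) (proj i V)

/-- The velocity `γ'(t)` of a curve in `SU(2)`, computed in the ambient space of matrices. -/
noncomputable def velocity (γ : ℝ → SU2) (t : ℝ) : Matrix (Fin 2) (Fin 2) ℂ :=
  Matrix.of (deriv (fun s : ℝ => fun i j => (γ s).1 i j) t)

theorem star_mul_velocity_mem (γ : ℝ → SU2) (t : ℝ) :
    star (γ t).1 * velocity γ t ∈ su2 := by
  by_cases hd : DifferentiableAt ℝ (fun s : ℝ => fun i j => (γ s).1 i j) t
  swap
  · have h : velocity γ t = 0 := by
      rw [velocity, deriv_zero_of_not_differentiableAt hd]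
      rfl
    rw [h, mul_zero]
    exact su2.zero_mem
  have hγ : ∀ i j, HasDerivAt (fun s : ℝ => (γ s).1 i j) (velocity γ t i j) t := by
    intro i j
    exact hasDerivAt_pi.1 (hasDerivAt_pi.1 hd.hasDerivAt i) j
  have hγ' : ∀ i j, HasDerivAt (fun s : ℝ => star ((γ s).1 i j)) (star (velocity γ t i j)) t :=
    fun i j => (hγ i j).star
  have hu : ∀ s, star (γ s).1 * (γ s).1 = 1 := fun s =>
    (Matrix.mem_unitaryGroup_iff').1 (Matrix.mem_specialUnitaryGroup_iff.1 (γ s).2).1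
  have hdet : ∀ s, (γ s).1 0 0 * (γ s).1 1 1 - (γ s).1 0 1 * (γ s).1 1 0 = 1 := fun s => by
    rw [← Matrix.det_fin_two]
    exact (Matrix.mem_specialUnitaryGroup_iff.1 (γ s).2).2
  have hinv : star (γ t).1 = (γ t).1.adjugate := by
    have h1 : (γ t).1 * (γ t).1.adjugate = 1 := by
      rw [Matrix.mul_adjugate, (Matrix.mem_specialUnitaryGroup_iff.1 (γ t).2).2, one_smul]
    exact left_inv_eq_right_inv (hu t) h1
  rw [mem_su2]
  constructor
  · rw [star_mul, star_star, eq_neg_iff_add_eq_zero]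
    ext i j
    have h1 := ((hγ' 0 i).mul (hγ 0 j)).add ((hγ' 1 i).mul (hγ 1 j))
    have h2 : (fun s : ℝ => star ((γ s).1 0 i) * (γ s).1 0 j + star ((γ s).1 1 i) * (γ s).1 1 j) =
        fun _ => (1 : Matrix (Fin 2) (Fin 2) ℂ) i j := by
      funext s
      have := congrFun (congrFun (hu s) i) j
      rw [← this, Matrix.mul_apply, Fin.sum_univ_two]
      rfl
    have h3 := h1.unique (h2 ▸ hasDerivAt_const t ((1 : Matrix (Fin 2) (Fin 2) ℂ) i j))
    simp only [Matrix.add_apply, Matrix.mul_apply, Fin.sum_univ_two, Matrix.star_apply,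
      Matrix.zero_apply]
    linear_combination h3
  · have h1 := ((hγ 0 0).mul (hγ 1 1)).sub ((hγ 0 1).mul (hγ 1 0))
    have h2 : (fun s : ℝ => (γ s).1 0 0 * (γ s).1 1 1 - (γ s).1 0 1 * (γ s).1 1 0) =
        fun _ => (1 : ℂ) := funext hdet
    have h3 := h1.unique (h2 ▸ hasDerivAt_const t (1 : ℂ))
    rw [hinv, Matrix.trace_fin_two, Matrix.adjugate_fin_two]
    simp only [Matrix.mul_apply, Fin.sum_univ_two, Matrix.of_apply, Matrix.cons_val_zero,
      Matrix.cons_val_one, Matrix.cons_val']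
    linear_combination h3

/-- The velocity `γ'(t)`, a tangent vector of `SU(2)` at `γ(t)`, translated back to the identity by
the left translation by `γ(t)⁻¹`. This is the element `γ(t)⁻¹ γ'(t)` of `𝔰𝔲(2)`; here `γ(t)⁻¹` is
the conjugate transpose of `γ(t)`. -/
noncomputable def leftVelocity (γ : ℝ → SU2) (t : ℝ) : su2 :=
  ⟨star (γ t).1 * velocity γ t, star_mul_velocity_mem γ t⟩

/-- The energy `½ ∫ₐᵇ g(γ', γ') dt` of a curve, where `g` is the left-invariant Riemannian metric
on `SU(2)` which is `⟨·,·⟩` at the identity. -/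
noncomputable def energy (lam : Fin 3 → ℝ) (γ : ℝ → SU2) (a b : ℝ) : ℝ :=
  (1 / 2) * ∫ t in a..b, innerLam lam (leftVelocity γ t) (leftVelocity γ t)

/-! ### Geodesics and geodesic vectors -/

/-- Smoothness of a curve in `SU(2)`. As `SU(2)` is an embedded submanifold of the space of
matrices, it is smoothness of the matrix entries. -/
def SmoothCurve (γ : ℝ → SU2) : Prop :=
  ∀ i j, ContDiff ℝ ∞ fun t : ℝ => (γ t).1 i j

/-- Smoothness of a two-parameter family of points of `SU(2)`. -/
def SmoothFamily (f : ℝ → ℝ → SU2) : Prop :=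
  ∀ i j, ContDiff ℝ ∞ fun p : ℝ × ℝ => (f p.1 p.2).1 i j

/-- `f` is a smooth variation, with fixed end points, of the restriction of `γ` to `[a, b]`. -/
structure IsProperVariation (γ : ℝ → SU2) (a b : ℝ) (f : ℝ → ℝ → SU2) : Prop where
  smooth : SmoothFamily f
  base : ∀ t ∈ Set.Icc a b, f 0 t = γ t
  left : ∀ s, f s a = γ a
  right : ∀ s, f s b = γ b

/-- A geodesic of the Riemannian manifold `SU(2)` with the metric `(λ₁, λ₂, λ₃)`: a smooth curve
whose restriction to any compact interval is a critical point of the energy among the curves with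
the same end points. -/
def IsGeodesic (lam : Fin 3 → ℝ) (γ : ℝ → SU2) : Prop :=
  SmoothCurve γ ∧ ∀ a b : ℝ, a < b → ∀ f : ℝ → ℝ → SU2, IsProperVariation γ a b f →
    HasDerivAt (fun s : ℝ => energy lam (f s) a b) 0 0

theorem exp_mem (X : su2) :
    NormedSpace.exp (X : Matrix (Fin 2) (Fin 2) ℂ) ∈ Matrix.specialUnitaryGroup (Fin 2) ℂ := by
  obtain ⟨A, hA, hT⟩ := X
  change NormedSpace.exp A ∈ _
  have hstar : star (NormedSpace.exp A) = NormedSpace.exp (-A) := by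
    rw [← hA]
    exact (Matrix.exp_conjTranspose A).symm
  have hunit : NormedSpace.exp A * NormedSpace.exp (-A) = 1 := by
    rw [Matrix.exp_neg]
    exact Matrix.mul_nonsing_inv _ ((Matrix.isUnit_iff_isUnit_det _).1 (Matrix.isUnit_exp A))
  refine Matrix.mem_specialUnitaryGroup_iff.2 ⟨?_, ?_⟩
  · rw [Matrix.mem_unitaryGroup_iff, hstar, hunit]
  -- with `J = !![0, 1; -1, 0]` one has `J Mᵀ J⁻¹ = adj M`, and `adj A = -A` as `A` has no trace
  · let J : Matrix (Fin 2) (Fin 2) ℂ := !![0, 1; -1, 0]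
    have hJdet : IsUnit J.det := by simp [J, Matrix.det_fin_two]
    have hJ : IsUnit J := (Matrix.isUnit_iff_isUnit_det _).2 hJdet
    have hadj : ∀ M : Matrix (Fin 2) (Fin 2) ℂ, J * M.transpose * J⁻¹ = M.adjugate := by
      intro M
      have h : J * M.transpose = M.adjugate * J := by
        ext i j
        fin_cases i <;> fin_cases j <;>
          simp [J, Matrix.adjugate_fin_two, Matrix.mul_apply, Fin.sum_univ_two]
      rw [h, Matrix.mul_assoc, Matrix.mul_nonsing_inv _ hJdet, Matrix.mul_one]
    have hAadj : A.adjugate = -A := by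
      rw [Matrix.trace_fin_two] at hT
      ext i j
      fin_cases i <;> fin_cases j <;> simp [Matrix.adjugate_fin_two] <;> linear_combination hT
    have key : (NormedSpace.exp A).adjugate = NormedSpace.exp (-A) := by
      rw [← hadj, ← Matrix.exp_transpose, ← Matrix.exp_conj J _ hJ, hadj, hAadj]
    have h := Matrix.mul_adjugate (NormedSpace.exp A)
    rw [key, hunit] at h
    have h00 := congrFun (congrFun h 0) 0
    simpa using h00.symm

/-- The exponential map `𝔰𝔲(2) → SU(2)`. -/
noncomputable def expSU2 (X : su2) : SU2 := ⟨NormedSpace.exp X.1, exp_mem X⟩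

/-- A nonzero vector `X` is a geodesic vector if `t ↦ exp (t X)` is a geodesic. -/
def IsGeodesicVector (lam : Fin 3 → ℝ) (X : su2) : Prop :=
  X ≠ 0 ∧ IsGeodesic lam fun t => expSU2 (t • X)

end SU2Geodesic

/-! By left invariance the energy of a family `M(s,t)` depends only on `A = M⁻¹ ∂ₜM`. With `H = M⁻¹
∂ₛM`, equality of mixed partials gives `∂ₛA = ∂ₜH + [A, H]` (`fstPartial_leftVelocity`). Along `exp
(tX)` one has `A = X`, so the derivative of the energy is `∫ ⟨X, ∂ₜH⟩ + ⟨X, [X, H]⟩`. The first term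
is exact and vanishes because the end points are fixed (`hasDerivAt_energy`). Hence `X` is geodesic
iff `⟨X, [X, Y]⟩ = 0` for all `Y` (`isGeodesicVector_iff_forall_innerLam_lie`).

In frame coordinates the bracket is the cross product and `B` is twice the dot product on each line.
The condition therefore becomes `(λᵢ - λⱼ) xᵢ xⱼ = 0` for all `i, j`
(`forall_innerLam_lie_eq_zero_iff`), and both cases of the theorem are read off from which of the
`λᵢ` coincide. -/

namespace SU2Geodesic

/-! ### Coordinates in the frame -/

/-- The real-linear functionals on matrices which restrict to the coordinates of `𝔰𝔲(2)` in the
basis `frame`. -/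
noncomputable def coord (i : Fin 3) : Matrix (Fin 2) (Fin 2) ℂ →ₗ[ℝ] ℝ where
  toFun A := ![2 * (A 0 0).im, 2 * (A 0 1).re, 2 * (A 0 1).im] i
  map_add' A B := by fin_cases i <;> simp <;> ring
  map_smul' c A := by fin_cases i <;> simp <;> ring

theorem coord_zero_apply (A : Matrix (Fin 2) (Fin 2) ℂ) : coord 0 A = 2 * (A 0 0).im := rfl

theorem coord_one_apply (A : Matrix (Fin 2) (Fin 2) ℂ) : coord 1 A = 2 * (A 0 1).re := rfl

theorem coord_two_apply (A : Matrix (Fin 2) (Fin 2) ℂ) : coord 2 A = 2 * (A 0 1).im := rfl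

theorem frame_apply (i : Fin 3) : frame i = frameVec i := by
  simp [frame]

/-- Since `coord` is defined on all matrices, coordinates can be differentiated along matrix-valued
curves without checking that the derivatives lie in `su2`. -/
theorem frame_repr (U : su2) (i : Fin 3) : frame.repr U i = coord i U := by
  have h := frameVec_sum_eq (frame.repr U)
  have hU : ∑ i, frame.repr U i • frameVec i = U := by
    simpa only [frame_apply] using frame.sum_repr U
  rw [hU] at h
  rw [h]
  fin_cases i <;> simp [coord] <;> ring

theorem coe_eq (U : su2) :
    (U : Matrix (Fin 2) (Fin 2) ℂ) =
      !![Complex.I * coord 0 U / 2, (coord 1 U + Complex.I * coord 2 U) / 2;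
        (-coord 1 U + Complex.I * coord 2 U) / 2, -(Complex.I * coord 0 U) / 2] := by
  have h := frameVec_sum_eq (frame.repr U)
  have hU : ∑ i, frame.repr U i • frameVec i = U := by
    simpa only [frame_apply] using frame.sum_repr U
  rw [hU] at h
  simpa only [frame_repr] using h

/-- The frame satisfies the cyclic relations of the standard basis of `ℝ³` under the cross product.
-/
theorem coord_lie (U V : su2) :
    coord 0 (⁅U, V⁆ : su2) = coord 1 U * coord 2 V - coord 2 U * coord 1 V ∧
    coord 1 (⁅U, V⁆ : su2) = coord 2 U * coord 0 V - coord 0 U * coord 2 V ∧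
    coord 2 (⁅U, V⁆ : su2) = coord 0 U * coord 1 V - coord 1 U * coord 0 V := by
  have h : ((⁅U, V⁆ : su2) : Matrix (Fin 2) (Fin 2) ℂ) =
      (U : Matrix (Fin 2) (Fin 2) ℂ) * V - V * U := rfl
  have hU := coe_eq U
  have hV := coe_eq V
  -- The right side of `hU` still mentions `U` through its coordinates; they become free reals
  -- before `U` is rewritten.
  generalize coord 0 U = u₀, coord 1 U = u₁, coord 2 U = u₂ at *
  generalize coord 0 V = v₀, coord 1 V = v₁, coord 2 V = v₂ at *
  rw [h, hU, hV, coord_zero_apply, coord_one_apply, coord_two_apply]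
  simp
  refine ⟨?_, ?_, ?_⟩ <;> ring

theorem coord_lie_zero (U V : su2) :
    coord 0 (⁅U, V⁆ : su2) = coord 1 U * coord 2 V - coord 2 U * coord 1 V :=
  (coord_lie U V).1

theorem coord_lie_one (U V : su2) :
    coord 1 (⁅U, V⁆ : su2) = coord 2 U * coord 0 V - coord 0 U * coord 2 V :=
  (coord_lie U V).2.1

theorem coord_lie_two (U V : su2) :
    coord 2 (⁅U, V⁆ : su2) = coord 0 U * coord 1 V - coord 1 U * coord 0 V :=
  (coord_lie U V).2.2

/-! ### The scalar product and the geodesic criterion in coordinates. -/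

theorem coord_frame (i j : Fin 3) : coord i (frame j) = if j = i then 1 else 0 := by
  rw [← frame_repr, Module.Basis.repr_self, Finsupp.single_apply]

/-- `ad (frame i)` kills `frame i` and rotates the other two basis vectors by a quarter turn, so its
square has trace `-2`. Off-diagonal values of `B` are not needed, as `innerLam` only pairs
projections to the same line. -/
theorem B_frame_self (i : Fin 3) : B (frame i) (frame i) = 2 := by
  rw [B, killingForm_apply_apply, LinearMap.trace_eq_matrix_trace ℝ frame, Matrix.trace]
  simp only [Matrix.diag_apply, LinearMap.toMatrix_apply, frame_repr, LinearMap.comp_apply,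
    LieAlgebra.ad_apply, coord_lie_zero, coord_lie_one, coord_lie_two, Fin.sum_univ_three, coord_frame]
  fin_cases i <;> simp <;> norm_num

theorem innerLam_eq (lam : Fin 3 → ℝ) (U V : su2) :
    innerLam lam U V = 2 * ∑ i, lam i * (coord i U * coord i V) := by
  rw [innerLam, Finset.mul_sum]
  refine Finset.sum_congr rfl fun i _ => ?_
  have h : B (proj i U) (proj i V) = coord i U * coord i V * B (frame i) (frame i) := by
    simp only [B, proj, frame_repr, map_smul, LinearMap.smul_apply, smul_eq_mul]
    ring
  rw [h, B_frame_self]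
  ring

/-- `X` is orthogonal to `X × Y` for the plain dot product, so only differences of the `λᵢ` survive.
-/
theorem innerLam_lie (lam : Fin 3 → ℝ) (X Y : su2) :
    innerLam lam X ⁅X, Y⁆ = 2 * ((lam 1 - lam 2) * coord 1 X * coord 2 X * coord 0 Y +
      (lam 2 - lam 0) * coord 2 X * coord 0 X * coord 1 Y +
      (lam 0 - lam 1) * coord 0 X * coord 1 X * coord 2 Y) := by
  rw [innerLam_eq]
  simp only [Fin.sum_univ_three, coord_lie_zero, coord_lie_one, coord_lie_two]
  ring

/-- The algebraic criterion `⟨X, [X, Y]⟩ = 0` in coordinates. -/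
theorem forall_innerLam_lie_eq_zero_iff (lam : Fin 3 → ℝ) (X : su2) :
    (∀ Y, innerLam lam X ⁅X, Y⁆ = 0) ↔
      ∀ i j, lam i ≠ lam j → coord i X = 0 ∨ coord j X = 0 := by
  simp only [innerLam_lie]
  constructor
  · intro h
    -- Each basis vector isolates one of the three products `(λᵢ - λⱼ) xᵢ xⱼ`.
    have h0 := h (frame 0)
    have h1 := h (frame 1)
    have h2 := h (frame 2)
    simp [coord_frame, sub_eq_zero] at h0 h1 h2
    intro i j hij
    fin_cases i <;> fin_cases j <;> simp at hij ⊢ <;> grind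
  · intro h Y
    have key : ∀ i j, (lam i - lam j) * coord i X * coord j X = 0 := by
      intro i j
      by_cases hij : lam i = lam j
      · rw [hij]; ring
      · rcases h i j hij with h | h <;> rw [h] <;> ring
    linear_combination 2 * coord 0 Y * key 1 2 + 2 * coord 1 Y * key 2 0 +
      2 * coord 2 Y * key 0 1

/-! ### The solution sets in terms of the lines `m k`. -/

theorem mem_m_iff (X : su2) (k : Fin 3) : X ∈ m k ↔ ∀ i, i ≠ k → coord i X = 0 := by
  rw [m, ← Set.image_singleton, Module.Basis.mem_span_image, Set.subset_singleton_iff]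
  simp only [Finset.mem_coe, Finsupp.mem_support_iff, frame_repr, ne_eq]
  exact forall_congr' fun i => not_imp_comm

theorem mem_m_sup_iff (X : su2) (i j : Fin 3) :
    X ∈ m i ⊔ m j ↔ ∀ l, l ≠ i → l ≠ j → coord l X = 0 := by
  rw [m, m, ← Submodule.span_union, ← Set.image_singleton, ← Set.image_singleton,
    ← Set.image_union, Module.Basis.mem_span_image]
  simp only [Set.subset_def, Finset.mem_coe, Finsupp.mem_support_iff, frame_repr, ne_eq,
    Set.mem_union, Set.mem_singleton_iff]
  exact forall_congr' fun l => by tauto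

/-- The only constraints left are `xᵢ xₖ = xⱼ xₖ = 0`: either `xₖ = 0`, or `xᵢ` and `xⱼ` both
vanish. -/
theorem criterion_iff_of_two_eq {lam : Fin 3 → ℝ} {i j k : Fin 3} (hij : i ≠ j)
    (heq : lam i = lam j) (hne : lam j ≠ lam k) (X : su2) :
    (∀ p q, lam p ≠ lam q → coord p X = 0 ∨ coord q X = 0) ↔ X ∈ m k ∨ X ∈ m i ⊔ m j := by
  have hjk : j ≠ k := fun h => hne (by rw [h])
  have hik : i ≠ k := fun h => hne (by rw [← heq, h])
  have hcases : ∀ l, l = i ∨ l = j ∨ l = k := by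
    intro l
    omega
  rw [mem_m_iff, mem_m_sup_iff]
  constructor
  · intro h
    have h1 := h i k (heq ▸ hne)
    have h2 := h j k hne
    by_cases hk : coord k X = 0
    · right
      intro l hl hl'
      rcases hcases l with rfl | rfl | rfl <;> tauto
    · left
      intro l hl
      rcases hcases l with rfl | rfl | rfl <;> tauto
  · rintro (h | h) p q hpq
    · by_cases hp : p = k
      · exact Or.inr (h q fun hq => hpq (by rw [hp, hq]))
      · exact Or.inl (h p hp)
    · have hk := h k hik.symm hjk.symm
      rcases hcases p with rfl | rfl | rfl <;> rcases hcases q with rfl | rfl | rfl <;>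
        first | exact Or.inl hk | exact Or.inr hk | exact absurd rfl hpq |
          exact absurd heq hpq | exact absurd heq.symm hpq

/-- All pairwise products of coordinates vanish, so at most one coordinate is nonzero. -/
theorem criterion_iff_of_injective {lam : Fin 3 → ℝ} (hinj : Function.Injective lam) (X : su2) :
    (∀ p q, lam p ≠ lam q → coord p X = 0 ∨ coord q X = 0) ↔
      X ∈ m 0 ∨ X ∈ m 1 ∨ X ∈ m 2 := by
  simp only [mem_m_iff, hinj.ne_iff, Fin.forall_fin_succ, IsEmpty.forall_iff]
  simp
  tauto

end SU2Geodesic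

namespace SU2Geodesic

/-! ### Calculus of functions of two real variables -/

section Calculus

variable {E : Type*} [NormedAddCommGroup E] [NormedSpace ℝ E]

/-- The partial derivative in the first variable. -/
noncomputable def fstPartial (F : ℝ × ℝ → E) (p : ℝ × ℝ) : E := fderiv ℝ F p (1, 0)

/-- The partial derivative in the second variable. -/
noncomputable def sndPartial (F : ℝ × ℝ → E) (p : ℝ × ℝ) : E := fderiv ℝ F p (0, 1)

theorem hasDerivAt_slice_left {F : ℝ × ℝ → E} (hF : ContDiff ℝ 1 F) (s t : ℝ) :
    HasDerivAt (fun s => F (s, t)) (fstPartial F (s, t)) s :=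
  ((hF.differentiable one_ne_zero) (s, t)).hasFDerivAt.comp_hasDerivAt s
    ((hasDerivAt_id s).prodMk (hasDerivAt_const s t))

theorem hasDerivAt_slice_right {F : ℝ × ℝ → E} (hF : ContDiff ℝ 1 F) (s t : ℝ) :
    HasDerivAt (fun t => F (s, t)) (sndPartial F (s, t)) t :=
  ((hF.differentiable one_ne_zero) (s, t)).hasFDerivAt.comp_hasDerivAt t
    ((hasDerivAt_const t s).prodMk (hasDerivAt_id t))

theorem contDiff_fstPartial {F : ℝ × ℝ → E} (hF : ContDiff ℝ ∞ F) :
    ContDiff ℝ ∞ (fstPartial F) :=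
  (hF.fderiv_right (m := ∞) (by simp)).clm_apply contDiff_const

theorem contDiff_sndPartial {F : ℝ × ℝ → E} (hF : ContDiff ℝ ∞ F) :
    ContDiff ℝ ∞ (sndPartial F) :=
  (hF.fderiv_right (m := ∞) (by simp)).clm_apply contDiff_const

theorem fstPartial_sndPartial_comm {F : ℝ × ℝ → E} (hF : ContDiff ℝ ∞ F) (p : ℝ × ℝ) :
    fstPartial (sndPartial F) p = sndPartial (fstPartial F) p := by
  have hd : DifferentiableAt ℝ (fderiv ℝ F) p :=
    (hF.fderiv_right (m := ∞) (by simp)).differentiable (by simp) p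
  have h (u : ℝ × ℝ) (q : ℝ × ℝ) :
      fderiv ℝ (fun p => fderiv ℝ F p u) p q = fderiv ℝ (fderiv ℝ F) p q u := by
    rw [fderiv_clm_apply hd (differentiableAt_const u)]
    simp
  exact (h _ _).trans (((hF.contDiffAt.isSymmSndFDerivAt
    (n := ∞) (by simpa using ENat.LEInfty.out)).eq _ _).trans (h _ _).symm)

theorem hasDerivAt_integral_of_contDiff [CompleteSpace E] {F : ℝ × ℝ → E} (hF : ContDiff ℝ 1 F)
    (a b s₀ : ℝ) :
    HasDerivAt (fun s => ∫ t in a..b, F (s, t))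
      (∫ t in a..b, fstPartial F (s₀, t)) s₀ := by
  have hF' : Continuous (fstPartial F) :=
    (hF.continuous_fderiv one_ne_zero).clm_apply continuous_const
  -- The dominating constant bounds the continuous partial derivative on a compact rectangle around
  -- `s₀`.
  obtain ⟨C, hC⟩ := (isCompact_Icc.prod isCompact_uIcc).exists_bound_of_continuousOn
    (s := Set.Icc (s₀ - 1) (s₀ + 1) ×ˢ Set.uIcc a b) hF'.continuousOn
  refine (intervalIntegral.hasDerivAt_integral_of_dominated_loc_of_deriv_le
    (F := fun s t => F (s, t)) (F' := fun s t => fstPartial F (s, t))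
    (s := Set.Icc (s₀ - 1) (s₀ + 1)) (bound := fun _ => C)
    (Icc_mem_nhds (by linarith) (by linarith)) ?_ ?_ ?_ ?_ ?_ ?_).2
  · exact Filter.Eventually.of_forall fun s =>
      (hF.continuous.comp (by fun_prop : Continuous fun t => (s, t))).aestronglyMeasurable
  · exact (hF.continuous.comp (by fun_prop : Continuous fun t => (s₀, t))).intervalIntegrable _ _
  · exact (hF'.comp (by fun_prop : Continuous fun t => (s₀, t))).aestronglyMeasurable
  · exact Filter.Eventually.of_forall fun t ht s hs =>
      hC (s, t) ⟨hs, Set.uIoc_subset_uIcc ht⟩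
  · exact intervalIntegrable_const
  · exact Filter.Eventually.of_forall fun t _ s _ => hasDerivAt_slice_left hF s t

end Calculus

/-! ### The first variation of the energy -/

section FirstVariation

open scoped Matrix.Norms.Operator

/-- Used for `starL'`, through which `star` is differentiated as a continuous real-linear map. -/
instance : ContinuousStar (Matrix (Fin 2) (Fin 2) ℂ) :=
  ⟨Continuous.matrix_conjTranspose continuous_id⟩

theorem contDiff_matrix_of_entries {E : Type*} [NormedAddCommGroup E] [NormedSpace ℝ E]
    {F : E → Matrix (Fin 2) (Fin 2) ℂ} (hF : ∀ i j, ContDiff ℝ ∞ fun p => F p i j) :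
    ContDiff ℝ ∞ F :=
  ((Matrix.ofLinearEquiv ℝ : (Fin 2 → Fin 2 → ℂ) ≃ₗ[ℝ]
    Matrix (Fin 2) (Fin 2) ℂ).toLinearMap.toContinuousLinearMap.contDiff (n := ∞)).comp
    (contDiff_pi' fun i => contDiff_pi' fun j => hF i j)

theorem contDiff_entry {E : Type*} [NormedAddCommGroup E] [NormedSpace ℝ E]
    {F : E → Matrix (Fin 2) (Fin 2) ℂ} (hF : ContDiff ℝ ∞ F) (i j : Fin 2) :
    ContDiff ℝ ∞ fun p => F p i j :=
  ((Matrix.entryLinearMap ℝ ℂ i j).toContinuousLinearMap.contDiff (n := ∞)).comp hF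

theorem contDiff_star {E : Type*} [NormedAddCommGroup E] [NormedSpace ℝ E]
    {F : E → Matrix (Fin 2) (Fin 2) ℂ} (hF : ContDiff ℝ ∞ F) :
    ContDiff ℝ ∞ fun p => star (F p) :=
  ((starL' ℝ : Matrix (Fin 2) (Fin 2) ℂ ≃L[ℝ] _).contDiff (n := ∞)).comp hF

theorem contDiff_coord {E : Type*} [NormedAddCommGroup E] [NormedSpace ℝ E]
    {F : E → Matrix (Fin 2) (Fin 2) ℂ} (hF : ContDiff ℝ ∞ F) (i : Fin 3) :
    ContDiff ℝ ∞ fun p => coord i (F p) :=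
  ((coord i).toContinuousLinearMap.contDiff (n := ∞)).comp hF

theorem hasDerivAt_coord {F : ℝ → Matrix (Fin 2) (Fin 2) ℂ} {F' : Matrix (Fin 2) (Fin 2) ℂ}
    {t : ℝ} (hF : HasDerivAt F F' t) (i : Fin 3) :
    HasDerivAt (fun t => coord i (F t)) (coord i F') t :=
  (coord i).toContinuousLinearMap.hasFDerivAt.comp_hasDerivAt t hF

theorem hasDerivAt_star {F : ℝ → Matrix (Fin 2) (Fin 2) ℂ} {F' : Matrix (Fin 2) (Fin 2) ℂ}
    {t : ℝ} (hF : HasDerivAt F F' t) : HasDerivAt (fun t => star (F t)) (star F') t :=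
  (starL' ℝ : Matrix (Fin 2) (Fin 2) ℂ ≃L[ℝ]
    _).toContinuousLinearMap.hasFDerivAt.comp_hasDerivAt t hF

/-! ### Left-translated velocities. -/

theorem star_mul_self_SU2 (g : SU2) : star g.1 * g.1 = 1 :=
  (Matrix.mem_unitaryGroup_iff').1 (Matrix.mem_specialUnitaryGroup_iff.1 g.2).1

theorem mul_star_self_SU2 (g : SU2) : g.1 * star g.1 = 1 :=
  (Matrix.mem_unitaryGroup_iff).1 (Matrix.mem_specialUnitaryGroup_iff.1 g.2).1

theorem coe_leftVelocity {γ : ℝ → SU2} {t : ℝ} {M' : Matrix (Fin 2) (Fin 2) ℂ}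
    (h : HasDerivAt (fun s => (γ s).1) M' t) :
    (leftVelocity γ t : Matrix (Fin 2) (Fin 2) ℂ) = star (γ t).1 * M' := by
  have hv : velocity γ t = M' := by
    have h' : HasDerivAt (fun s : ℝ => fun i j => (γ s).1 i j) (fun i j => M' i j) t := h
    rw [velocity, h'.deriv]
    rfl
  rw [← hv]
  rfl

/-- A proper variation agrees with the base curve only on `[a, b]`, so velocities can be compared
only at interior points, by a local argument. -/
theorem leftVelocity_congr {γ γ' : ℝ → SU2} {t : ℝ} (h : γ =ᶠ[nhds t] γ') :
    leftVelocity γ t = leftVelocity γ' t := by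
  apply Subtype.ext
  change star (γ t).1 * velocity γ t = star (γ' t).1 * velocity γ' t
  have h' : (fun s : ℝ => fun i j => (γ s).1 i j) =ᶠ[nhds t] fun s => fun i j => (γ' s).1 i j :=
    h.mono fun s hs => by simp only [hs]
  rw [h.eq_of_nhds, velocity, velocity, h'.deriv_eq]

theorem hasDerivAt_expSU2 (X : su2) (t : ℝ) :
    HasDerivAt (fun t : ℝ => (expSU2 (t • X)).1) ((expSU2 (t • X)).1 * X) t :=
  hasDerivAt_exp_smul_const (X : Matrix (Fin 2) (Fin 2) ℂ) t

theorem leftVelocity_expSU2 (X : su2) (t : ℝ) :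
    leftVelocity (fun t : ℝ => expSU2 (t • X)) t = X := by
  apply Subtype.ext
  rw [coe_leftVelocity (hasDerivAt_expSU2 X t), ← mul_assoc, star_mul_self_SU2, one_mul]

theorem contDiff_expSU2 (X : su2) : ContDiff ℝ ∞ fun t : ℝ => (expSU2 (t • X)).1 := by
  have h : ContDiff ℝ ∞ (NormedSpace.exp : Matrix (Fin 2) (Fin 2) ℂ → _) :=
    AnalyticOnNhd.contDiff fun x _ => NormedSpace.exp_analytic x
  exact h.comp (contDiff_id.smul contDiff_const)

/-- If `A = M⁻¹ ∂ₜM` and `H = M⁻¹ ∂ₛM` for a smooth family `M`, then `∂ₛA = ∂ₜH + [A, H]`. -/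
theorem fstPartial_leftVelocity {f : ℝ → ℝ → SU2} {M : ℝ × ℝ → Matrix (Fin 2) (Fin 2) ℂ}
    (hMf : ∀ p, M p = (f p.1 p.2).1) (hM : ContDiff ℝ ∞ M) (s t : ℝ) :
    fstPartial (fun p => star (M p) * sndPartial M p) (s, t) =
      sndPartial (fun p => star (M p) * fstPartial M p) (s, t) +
      (star (M (s, t)) * sndPartial M (s, t) * (star (M (s, t)) * fstPartial M (s, t)) -
        star (M (s, t)) * fstPartial M (s, t) *
          (star (M (s, t)) * sndPartial M (s, t))) := by
  have h1 : ∀ p, star (M p) * M p = 1 := fun p => by rw [hMf]; exact star_mul_self_SU2 _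
  have h2 : ∀ p, M p * star (M p) = 1 := fun p => by rw [hMf]; exact mul_star_self_SU2 _
  have hM1 := hM.of_le (m := 1) (by simp)
  have hMs := hasDerivAt_slice_left hM1 s t
  have hMt := hasDerivAt_slice_right hM1 s t
  have hcs := contDiff_fstPartial hM
  have hct := contDiff_sndPartial hM
  have hMst := hasDerivAt_slice_left (hct.of_le (m := 1) (by simp)) s t
  have hMts := hasDerivAt_slice_right (hcs.of_le (m := 1) (by simp)) s t
  have hA := (hasDerivAt_slice_left (((contDiff_star hM).mul hct).of_le (m := 1) (by simp))
    s t).unique ((hasDerivAt_star hMs).mul hMst)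
  have hH := (hasDerivAt_slice_right (((contDiff_star hM).mul hcs).of_le (m := 1) (by simp))
    s t).unique ((hasDerivAt_star hMt).mul hMts)
  -- Differentiating `M* M = 1` shows that `M* ∂M` is skew-Hermitian.
  have hs : star (fstPartial M (s, t)) * M (s, t) =
      -(star (M (s, t)) * fstPartial M (s, t)) := by
    have h := (hasDerivAt_star hMs).mul hMs
    simp only [Pi.mul_def, h1] at h
    exact eq_neg_of_add_eq_zero_left (h.unique (hasDerivAt_const s _))
  have ht : star (sndPartial M (s, t)) * M (s, t) =
      -(star (M (s, t)) * sndPartial M (s, t)) := by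
    have h := (hasDerivAt_star hMt).mul hMt
    simp only [Pi.mul_def, h1] at h
    exact eq_neg_of_add_eq_zero_left (h.unique (hasDerivAt_const t _))
  -- Inserting `M M* = 1` turns `(∂ₛM)* ∂ₜM` into `-HA` and `(∂ₜM)* ∂ₛM` into `-AH`; their
  -- difference is the commutator.
  have key : ∀ P Q : Matrix (Fin 2) (Fin 2) ℂ, star P * Q =
      star P * M (s, t) * (star (M (s, t)) * Q) := fun P Q => by
    rw [mul_assoc, ← mul_assoc (M (s, t)), h2, one_mul]
  rw [hA, hH, fstPartial_sndPartial_comm hM,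
    key (fstPartial M (s, t)), key (sndPartial M (s, t)), hs, ht]
  noncomm_ring

/-- The first variation of the energy at a one-parameter subgroup. -/
theorem hasDerivAt_energy {lam : Fin 3 → ℝ} {X : su2} {a b : ℝ} (hab : a < b)
    {f : ℝ → ℝ → SU2} (hf : IsProperVariation (fun t => expSU2 (t • X)) a b f) :
    HasDerivAt (fun s => energy lam (f s) a b)
      (∫ t in a..b, innerLam lam X ⁅X, leftVelocity (fun s => f s t) 0⁆) 0 := by
  set M : ℝ × ℝ → Matrix (Fin 2) (Fin 2) ℂ := fun p => (f p.1 p.2).1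
  have hM : ContDiff ℝ ∞ M := contDiff_matrix_of_entries hf.smooth
  have hM1 : ContDiff ℝ 1 M := hM.of_le (by simp)
  set A : ℝ × ℝ → Matrix (Fin 2) (Fin 2) ℂ := fun p => star (M p) * sndPartial M p
  set H : ℝ × ℝ → Matrix (Fin 2) (Fin 2) ℂ := fun p => star (M p) * fstPartial M p with hHdef
  have hA : ContDiff ℝ ∞ A := (contDiff_star hM).mul (contDiff_sndPartial hM)
  have hH : ContDiff ℝ ∞ H := (contDiff_star hM).mul (contDiff_fstPartial hM)
  have hA1 : ContDiff ℝ 1 A := hA.of_le (by simp)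
  have hH1 : ContDiff ℝ 1 H := hH.of_le (by simp)
  have hAv : ∀ s t, (leftVelocity (f s) t : Matrix (Fin 2) (Fin 2) ℂ) = A (s, t) := fun s t =>
    coe_leftVelocity (hasDerivAt_slice_right hM1 s t)
  have hHv : ∀ s t, (leftVelocity (fun s => f s t) s : Matrix (Fin 2) (Fin 2) ℂ) = H (s, t) :=
    fun s t => coe_leftVelocity (γ := fun s => f s t) (hasDerivAt_slice_left hM1 s t)
  have hAX : ∀ t ∈ Set.Ioo a b, A (0, t) = X := by
    intro t ht
    rw [← hAv, leftVelocity_congr, leftVelocity_expSU2 X t]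
    filter_upwards [Ioo_mem_nhds ht.1 ht.2] with u hu
    exact hf.base u (Set.Ioo_subset_Icc_self hu)
  have hHend : ∀ t, (∀ s, f s t = f 0 t) → H (0, t) = 0 := by
    intro t ht
    have h : HasDerivAt (fun s => M (s, t)) 0 0 := by
      have : (fun s => M (s, t)) = fun _ => (f 0 t).1 := by
        funext s
        exact congrArg Subtype.val (ht s)
      rw [this]
      exact hasDerivAt_const _ _
    rw [hHdef]
    simp only
    rw [(hasDerivAt_slice_left hM1 0 t).unique h, mul_zero]
  have hHa : H (0, a) = 0 := hHend a fun s => by rw [hf.left, hf.left]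
  have hHb : H (0, b) = 0 := hHend b fun s => by rw [hf.right, hf.right]
  -- The `1/2` in the energy cancels the factor `2` of `innerLam_eq`.
  set L : ℝ × ℝ → ℝ := fun p => ∑ i, lam i * (coord i (A p) * coord i (A p))
  have hL : ContDiff ℝ 1 L := by
    refine ContDiff.of_le (n := ∞) ?_ (by simp)
    exact ContDiff.sum fun i _ => contDiff_const.mul ((contDiff_coord hA i).mul
      (contDiff_coord hA i))
  have henergy : (fun s => energy lam (f s) a b) = fun s => ∫ t in a..b, L (s, t) := by
    funext s
    simp only [energy, innerLam_eq, hAv]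
    rw [intervalIntegral.integral_const_mul]
    ring
  have hL' : ∀ t, fstPartial L (0, t) =
      2 * ∑ i, lam i * (coord i (A (0, t)) * coord i (fstPartial A (0, t))) := by
    intro t
    have hc := fun i => hasDerivAt_coord (hasDerivAt_slice_left hA1 0 t) i
    have h := HasDerivAt.fun_sum (u := Finset.univ) fun i _ =>
      ((hc i).fun_mul (hc i)).const_mul (lam i)
    rw [(hasDerivAt_slice_left hL 0 t).unique h, Finset.mul_sum]
    exact Finset.sum_congr rfl fun i _ => by ring
  -- `G = ⟨X, H⟩` is the primitive of the exact term; it vanishes at `a` and `b`.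
  set G : ℝ → ℝ := fun t => 2 * ∑ i, lam i * (coord i X * coord i (H (0, t))) with hGdef
  have hHt : ContDiff ℝ ∞ fun t => sndPartial H (0, t) :=
    (contDiff_sndPartial hH).comp (contDiff_const.prodMk contDiff_id)
  set G' : ℝ → ℝ := fun t => 2 * ∑ i, lam i * (coord i X * coord i (sndPartial H (0, t)))
    with hG'def
  have hG : ∀ t, HasDerivAt G (G' t) t := by
    intro t
    have hc := fun i => hasDerivAt_coord (hasDerivAt_slice_right hH1 0 t) i
    exact (HasDerivAt.fun_sum (u := Finset.univ) fun i _ =>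
      ((hc i).const_mul (coord i X)).const_mul (lam i)).const_mul 2
  have hG'cont : Continuous G' :=
    continuous_const.mul (continuous_finsetSum _ fun i _ => continuous_const.mul
      (continuous_const.mul (contDiff_coord hHt i).continuous))
  set K : ℝ → ℝ := fun t => innerLam lam X ⁅X, leftVelocity (fun s => f s t) 0⁆ with hKdef
  have hKcont : Continuous K := by
    simp only [hKdef, innerLam_lie, hHv]
    have hc := fun i => (contDiff_coord (hH.comp
      ((contDiff_const.prodMk contDiff_id) : ContDiff ℝ ∞ fun t : ℝ => ((0 : ℝ), t))) i).continuous
    simp only [Function.comp_def] at hc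
    have h0 := hc 0
    have h1 := hc 1
    have h2 := hc 2
    fun_prop
  have hint : ∫ t in a..b, fstPartial L (0, t) = ∫ t in a..b, K t := by
    have h1 : ∫ t in a..b, fstPartial L (0, t) = ∫ t in a..b, (G' t + K t) := by
      -- The open interval suffices for the integral, and `A (0, t) = X` is known only there.
      refine intervalIntegral.integral_congr_Ioo_of_le hab.le fun t ht => ?_
      have hlie : ((⁅X, leftVelocity (fun s => f s t) 0⁆ : su2) : Matrix (Fin 2) (Fin 2) ℂ) =
          X * H (0, t) - H (0, t) * X := by
        rw [← hHv]
        rfl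
      have hA' : fstPartial A (0, t) =
          sndPartial H (0, t) + (A (0, t) * H (0, t) - H (0, t) * A (0, t)) :=
        fstPartial_leftVelocity (f := f) (fun p => rfl) hM 0 t
      simp only [hL', hG'def, hKdef, innerLam_eq]
      rw [hlie, hA', hAX t ht, ← mul_add, ← Finset.sum_add_distrib]
      congr 1
      refine Finset.sum_congr rfl fun i _ => ?_
      rw [map_add]
      ring
    rw [h1, intervalIntegral.integral_add (hG'cont.intervalIntegrable _ _)
      (hKcont.intervalIntegrable _ _),
      intervalIntegral.integral_eq_sub_of_hasDerivAt (fun t _ => hG t)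
      (hG'cont.intervalIntegrable _ _)]
    simp [hGdef, hHa, hHb]
  rw [henergy, ← hint]
  exact hasDerivAt_integral_of_contDiff hL a b 0

/-- `X` is a geodesic vector if and only if `⟨X, [X, Y]⟩ = 0` for all `Y`. -/
theorem isGeodesicVector_iff_forall_innerLam_lie (lam : Fin 3 → ℝ) (X : su2) :
    IsGeodesicVector lam X ↔ X ≠ 0 ∧ ∀ Y, innerLam lam X ⁅X, Y⁆ = 0 := by
  refine and_congr_right fun _ => ⟨fun h Y => ?_, fun h => ⟨fun i j =>
    contDiff_entry (contDiff_expSU2 X) i j, fun a b hab f hf => ?_⟩⟩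
  -- The factor `t (1 - t)` fixes the end points of `[0, 1]`; multiplying on the right makes the
  -- left-translated variation field `t (1 - t) Y`. The first variation is then `⟨X, [X, Y]⟩ / 6`.
  · let f : ℝ → ℝ → SU2 := fun s t => expSU2 (t • X) * expSU2 ((s * (t * (1 - t))) • Y)
    have hone : expSU2 0 = 1 := Subtype.ext NormedSpace.exp_zero
    have hf : IsProperVariation (fun t => expSU2 (t • X)) 0 1 f := by
      refine ⟨fun i j => contDiff_entry (E := ℝ × ℝ) (F := fun p => (f p.1 p.2).1) ?_ i j,
        fun t _ => ?_, fun s => ?_, fun s => ?_⟩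
      · exact ((contDiff_expSU2 X).comp contDiff_snd).mul ((contDiff_expSU2 Y).comp
          (contDiff_fst.mul (contDiff_snd.mul (contDiff_const.sub contDiff_snd))))
      all_goals simp [f, hone]
    have hv : ∀ t, leftVelocity (fun s => f s t) 0 = (t * (1 - t)) • Y := by
      intro t
      apply Subtype.ext
      have h1 := (hasDerivAt_expSU2 Y (0 * (t * (1 - t)))).scomp (0 : ℝ)
        ((hasDerivAt_id (0 : ℝ)).mul_const (t * (1 - t)))
      have h2 : HasDerivAt (fun s => (f s t).1) _ 0 := h1.const_mul (expSU2 (t • X)).1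
      rw [coe_leftVelocity (γ := fun s => f s t) h2]
      simp [f, hone, ← mul_assoc, star_mul_self_SU2]
    have h0 := (hasDerivAt_energy (lam := lam) one_pos hf).unique (h.2 0 1 one_pos f hf)
    have hlin : ∀ c : ℝ, innerLam lam X ⁅X, c • Y⁆ = c * innerLam lam X ⁅X, Y⁆ := by
      intro c
      have hc : ∀ i, coord i (c • Y : su2) = c * coord i Y := fun i => map_smul (coord i) c Y.1
      simp only [innerLam_lie, hc]
      ring
    have hphi : ∫ t in (0 : ℝ)..1, t * (1 - t) = 1 / 6 := by
      simp only [mul_sub, mul_one, ← sq]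
      rw [intervalIntegral.integral_sub (continuous_id'.intervalIntegrable _ _)
        ((continuous_pow 2).intervalIntegrable _ _)]
      simp
      norm_num
    simp only [hv, hlin] at h0
    rw [intervalIntegral.integral_mul_const, hphi] at h0
    linarith
  · simpa [h] using hasDerivAt_energy (lam := lam) hab hf

end FirstVariation

end SU2Geodesic

theorem proposition4p3 (lam : Fin 3 → ℝ) (hlam : ∀ i, 0 < lam i) :
    (∀ i j k : Fin 3, i ≠ j → lam i = lam j → lam j ≠ lam k →
      ∀ X : SU2Geodesic.su2, SU2Geodesic.IsGeodesicVector lam X ↔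
        X ≠ 0 ∧ (X ∈ SU2Geodesic.m k ∨ X ∈ SU2Geodesic.m i ⊔ SU2Geodesic.m j)) ∧
    (Function.Injective lam →
      ∀ X : SU2Geodesic.su2, SU2Geodesic.IsGeodesicVector lam X ↔
        X ≠ 0 ∧ (X ∈ SU2Geodesic.m 0 ∨ X ∈ SU2Geodesic.m 1 ∨ X ∈ SU2Geodesic.m 2)) := by
  refine ⟨fun i j k hij heq hne X => ?_, fun hinj X => ?_⟩
  · rw [SU2Geodesic.isGeodesicVector_iff_forall_innerLam_lie,
      SU2Geodesic.forall_innerLam_lie_eq_zero_iff,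
      SU2Geodesic.criterion_iff_of_two_eq hij heq hne]
  · rw [SU2Geodesic.isGeodesicVector_iff_forall_innerLam_lie,
      SU2Geodesic.forall_innerLam_lie_eq_zero_iff, SU2Geodesic.criterion_iff_of_injective hinj]
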